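/- Let $\mathcal V$ be a real separable Hilbert space with an orthonormal basis $(e_k)$, and let $(Z_i)_{i\in\mathbb Z}$ be a strictly stationary centred Gaussian sequence with values in $\mathcal V$ (all finite families are jointly Gaussian). Let $Q(i-j)=\operatorname{cov}(Z_i,Z_j)$ be its auto-covariance operators, i.e. $\mathbb E(\langle Z_i,v\rangle\langle Z_j,w\rangle)=\langle Q(i-j)v,w\rangle$ for all $v,w\in\mathcal V$, and assume that the covariance operator $Q=Q(0)$ is not $0$. For $n\ge 1$ put $$V_n=\frac1{\sqrt n}\sum_{i=1}^n\bigl(|Z_i|^2-\operatorname{Tr}(Q)\bigr),\qquad s_n=\mathbb E V_n^2,\qquad F_n=\frac{V_n}{\sqrt{s_n}} .$$ Let $|T|_{HS}=(\sum_k|Te_k|^2)^{1/2}$ be the Hilbert–Schmidt norm and let $\kappa_3,\kappa_4$ denote the third and the fourth cumulant. Then $Q$ is of trace class, every $Q(i)$ is Hilbert–Schmidt and, for every $n\ge1$, $s_n>0$ and $F_n\in L^4$, so that all these quantities are well defined. Moreover, for every constant $C_1>8$ and for some universal constant $C_2>0$ (independent of $\mathcal V$, of the sequence $(Z_i)$ and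 of $n$), for every $n\ge1$, $$\kappa_3(F_n)\le\frac{C_1}{\sqrt n\,s_n^{3/2}}\Bigl(\sum_{|i|<n}|Q(i)|_{HS}^{3/2}\Bigr)^2,\qquad \kappa_4(F_n)\le\frac{C_2}{n\,s_n^{2}}\Bigl(\sum_{|i|<n}|Q(i)|_{HS}^{4/3}\Bigr)^3 .$$ -/

import Mathlib

open MeasureTheory ProbabilityTheory

namespace GaussSeq

section Cumulants

variable {Ω : Type*} [MeasurableSpace Ω]

/-- The cumulants of a real random variable `X` with finite moments, through the standard
moment-cumulant recursion `κ_{n+1} = m_{n+1} - ∑_{j<n} C(n, j) κ_{j+1} m_{n-j}`, where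
`m_k = E[X ^ k]` (the coefficients of the formal power series `log (∑ m_k t^k / k!)`). -/
noncomputable def cumulant (X : Ω → ℝ) (P : Measure Ω) : ℕ → ℝ
  | 0 => 0
  | n + 1 => (∫ ω, X ω ^ (n + 1) ∂P)
      - ∑ j : Fin n, (n.choose j : ℝ) * cumulant X P (j + 1) * ∫ ω, X ω ^ (n - (j : ℕ)) ∂P

theorem cumulant_succ (X : Ω → ℝ) (P : Measure Ω) (n : ℕ) :
    cumulant X P (n + 1) = (∫ ω, X ω ^ (n + 1) ∂P)
      - ∑ j : Fin n, (n.choose j : ℝ) * cumulant X P (j + 1) * ∫ ω, X ω ^ (n - (j : ℕ)) ∂P := by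
  rw [cumulant]

theorem cumulant_one (X : Ω → ℝ) (P : Measure Ω) : cumulant X P 1 = ∫ ω, X ω ∂P := by
  rw [show (1 : ℕ) = 0 + 1 from rfl, cumulant_succ]
  simp

theorem cumulant_two (X : Ω → ℝ) (P : Measure Ω) :
    cumulant X P 2 = (∫ ω, X ω ^ 2 ∂P) - (∫ ω, X ω ∂P) ^ 2 := by
  rw [show (2 : ℕ) = 1 + 1 from rfl, cumulant_succ, Fin.sum_univ_one]
  simp [cumulant_one, sq]

theorem cumulant_three (X : Ω → ℝ) (P : Measure Ω) :
    cumulant X P 3 = (∫ ω, X ω ^ 3 ∂P) - 3 * (∫ ω, X ω ^ 2 ∂P) * (∫ ω, X ω ∂P)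
      + 2 * (∫ ω, X ω ∂P) ^ 3 := by
  rw [show (3 : ℕ) = 2 + 1 from rfl, cumulant_succ, Fin.sum_univ_two]
  simp [cumulant_one, cumulant_two]
  ring

theorem cumulant_four (X : Ω → ℝ) (P : Measure Ω) :
    cumulant X P 4 = (∫ ω, X ω ^ 4 ∂P) - 4 * (∫ ω, X ω ^ 3 ∂P) * (∫ ω, X ω ∂P)
      - 3 * (∫ ω, X ω ^ 2 ∂P) ^ 2 + 12 * (∫ ω, X ω ^ 2 ∂P) * (∫ ω, X ω ∂P) ^ 2
      - 6 * (∫ ω, X ω ∂P) ^ 4 := by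
  have h := cumulant_succ X P 3
  rw [Fin.sum_univ_three] at h
  refine h.trans ?_
  simp [cumulant_one, cumulant_two, cumulant_three]
  ring

end Cumulants

section Operators

variable {V : Type*} [NormedAddCommGroup V] [InnerProductSpace ℝ V] {ι : Type*}

/-- The sum `∑ ⟨T e_k, e_k⟩` is convergent; for a positive operator `T` this says that `T` is
of trace class. -/
def HasTrace (e : HilbertBasis ι ℝ V) (T : V →L[ℝ] V) : Prop :=
  Summable fun k => inner ℝ (T (e k)) (e k)

/-- The trace `Tr T = ∑ ⟨T e_k, e_k⟩`. -/
noncomputable def trace (e : HilbertBasis ι ℝ V) (T : V →L[ℝ] V) : ℝ :=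
  ∑' k, inner ℝ (T (e k)) (e k)

/-- `T` is a Hilbert-Schmidt operator. -/
def IsHilbertSchmidt (e : HilbertBasis ι ℝ V) (T : V →L[ℝ] V) : Prop :=
  Summable fun k => ‖T (e k)‖ ^ 2

/-- The Hilbert-Schmidt norm `(∑ ‖T e_k‖ ^ 2) ^ (1/2)`. -/
noncomputable def hsNorm (e : HilbertBasis ι ℝ V) (T : V →L[ℝ] V) : ℝ :=
  √(∑' k, ‖T (e k)‖ ^ 2)

end Operators

section Sequences

variable {Ω : Type*} [MeasurableSpace Ω]
  {V : Type*} [NormedAddCommGroup V] [InnerProductSpace ℝ V]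

/-- The covariance operator `cov(X, Y)`, that is, the expectation of the rank-one operator
`v ↦ ⟨X - E X, v⟩ (Y - E Y)`. -/
noncomputable def covOp (X Y : Ω → V) (P : Measure Ω) : V →L[ℝ] V :=
  ∫ ω, InnerProductSpace.rankOne ℝ (Y ω - ∫ ω', Y ω' ∂P) (X ω - ∫ ω', X ω' ∂P) ∂P

/-- For square-integrable centred variables, `E (⟨X, v⟩ ⟨Y, w⟩) = ⟨cov(X, Y) v, w⟩`. -/
theorem inner_covOp [CompleteSpace V] {X Y : Ω → V} {P : Measure Ω}
    (hX : MemLp X 2 P) (hY : MemLp Y 2 P) (hX0 : ∫ ω, X ω ∂P = 0) (hY0 : ∫ ω, Y ω ∂P = 0)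
    (v w : V) :
    inner ℝ (covOp X Y P v) w = ∫ ω, inner ℝ (X ω) v * inner ℝ (Y ω) w ∂P := by
  have hmeas : AEStronglyMeasurable (fun ω => InnerProductSpace.rankOne ℝ (Y ω) (X ω)) P :=
    (InnerProductSpace.rankOne ℝ (E := V) (F := V)).continuous₂.comp_aestronglyMeasurable₂
      hY.1 hX.1
  have hint : Integrable (fun ω => InnerProductSpace.rankOne ℝ (Y ω) (X ω)) P :=
    Integrable.mono' (hY.norm.integrable_mul hX.norm) hmeas
      (Filter.Eventually.of_forall fun ω => le_of_eq (InnerProductSpace.norm_rankOne _ _))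
  have h2 := ContinuousLinearMap.integral_apply hint v
  have h3 := hint.apply_continuousLinearMap v
  simp only [covOp, hX0, hY0, sub_zero]
  rw [h2, real_inner_comm, ← integral_inner h3]
  refine integral_congr_ae (Filter.Eventually.of_forall fun ω => ?_)
  simp only [InnerProductSpace.rankOne_apply, inner_smul_right]
  rw [real_inner_comm w]

/-- The auto-covariance operators `Q(k) = cov(Z_k, Z_0)`, equal to `cov(Z_i, Z_j)` whenever
`i - j = k` if the sequence is stationary; `Q = Q(0)`. -/
noncomputable def autoCov (Z : ℤ → Ω → V) (P : Measure Ω) (k : ℤ) : V →L[ℝ] V :=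
  covOp (Z k) (Z 0) P

/-- Strict stationarity: all shifts of the sequence have the same law on `V ^ ℤ`. -/
def IsStationary [MeasurableSpace V] (Z : ℤ → Ω → V) (P : Measure Ω) : Prop :=
  ∀ h : ℤ, IdentDistrib (fun ω i => Z (i + h) ω) (fun ω i => Z i ω) P P

/-- For a stationary centred square-integrable sequence,
`E (⟨Z_i, v⟩ ⟨Z_j, w⟩) = ⟨Q(i - j) v, w⟩`. -/
theorem inner_autoCov [CompleteSpace V] [MeasurableSpace V] [BorelSpace V]
    {Z : ℤ → Ω → V} {P : Measure Ω} (hZ : ∀ i, MemLp (Z i) 2 P)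
    (hZ0 : ∀ i, ∫ ω, Z i ω ∂P = 0) (hstat : IsStationary Z P) (i j : ℤ) (v w : V) :
    inner ℝ (autoCov Z P (i - j) v) w = ∫ ω, inner ℝ (Z i ω) v * inner ℝ (Z j ω) w ∂P := by
  rw [autoCov, inner_covOp (hZ _) (hZ _) (hZ0 _) (hZ0 _)]
  have hm : ∀ u : V, Measurable fun x : V => inner ℝ x u := fun u =>
    (continuous_id.inner continuous_const).measurable
  have hg : Measurable fun x : ℤ → V => inner ℝ (x (i - j)) v * inner ℝ (x 0) w :=
    ((hm v).comp (measurable_pi_apply _)).mul ((hm w).comp (measurable_pi_apply _))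
  have h := ((hstat j).comp hg).integral_eq
  simpa using h.symm

/-- `V_n = n ^ (-1/2) ∑_{i=1}^n (‖Z_i‖² - Tr Q)`. -/
noncomputable def sampleV {ι : Type*} (e : HilbertBasis ι ℝ V) (Z : ℤ → Ω → V) (P : Measure Ω)
    (n : ℕ) (ω : Ω) : ℝ :=
  1 / √(n : ℝ) * ∑ i ∈ Finset.Icc (1 : ℤ) n, (‖Z i ω‖ ^ 2 - trace e (autoCov Z P 0))

/-- `s_n = E V_n²`. -/
noncomputable def sampleS {ι : Type*} (e : HilbertBasis ι ℝ V) (Z : ℤ → Ω → V) (P : Measure Ω)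
    (n : ℕ) : ℝ :=
  ∫ ω, sampleV e Z P n ω ^ 2 ∂P

/-- `F_n = V_n / √s_n`. -/
noncomputable def sampleF {ι : Type*} (e : HilbertBasis ι ℝ V) (Z : ℤ → Ω → V) (P : Measure Ω)
    (n : ℕ) (ω : Ω) : ℝ :=
  sampleV e Z P n ω / √(sampleS e Z P n)

end Sequences

end GaussSeq

/-! Restrict `∑ (‖Z_i‖² - Tr Q)` to finitely many coordinates `S`. It becomes `|X|² - E|X|²` for a
centred Gaussian vector `X` with covariance matrix `M`. An orthogonal change of basis turns this
into a sum of independent variables `Y_j² - λ_j`, with `λ_j` the eigenvalues of `M`, so its second,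
third and fourth cumulants are `2 tr M²`, `8 tr M³` and `48 tr M⁴`
(`moments_quadratic_of_hasGaussianLaw`). This is the source of both constants.

The blocks of `M` are compressions of `Q(i - j)`, so the traces are at most cyclic sums of
Hilbert-Schmidt norms `q(i - j)` (`trace_pow_three_le`, `trace_pow_four_le`). A cyclic product is
the geometric mean of the products that omit one factor, raised to the power `3/2` (or `4/3` for
four factors). By AM-GM the cycle is thus bounded by open paths, and summing those out edge by edge
gives `n (∑ q^(3/2))²` and `n (∑ q^(4/3))³`.

These bounds do not depend on `S`, so dominated convergence carries them to the full sum
(`moments_fullSum_le`). Normalising gives the powers of `n` and `s_n`. -/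

namespace GaussSeq

open scoped ENNReal NNReal

/-! ### Variables with moments of every order -/

section AllMoments

variable {Ω : Type*} [MeasurableSpace Ω] {P : Measure Ω}

/-- All absolute moments of `f` are finite. -/
def HasAllMoments (f : Ω → ℝ) (P : Measure Ω) : Prop := ∀ p : ℝ≥0, MemLp f p P

namespace HasAllMoments

variable {f g : Ω → ℝ}

theorem memLp (hf : HasAllMoments f P) {p : ℝ≥0∞} (hp : p ≠ ∞) : MemLp f p P := by
  lift p to ℝ≥0 using hp
  exact hf p

theorem integrable (hf : HasAllMoments f P) : Integrable f P :=
  memLp_one_iff_integrable.1 (hf.memLp (by simp))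

theorem const [IsFiniteMeasure P] (c : ℝ) : HasAllMoments (fun _ : Ω => c) P :=
  fun _ => memLp_const c

theorem add (hf : HasAllMoments f P) (hg : HasAllMoments g P) :
    HasAllMoments (fun ω => f ω + g ω) P := fun p => (hf p).add (hg p)

theorem sub (hf : HasAllMoments f P) (hg : HasAllMoments g P) :
    HasAllMoments (fun ω => f ω - g ω) P := fun p => (hf p).sub (hg p)

theorem const_mul (hf : HasAllMoments f P) (c : ℝ) : HasAllMoments (fun ω => c * f ω) P :=
  fun p => (hf p).const_mul c

theorem mul (hf : HasAllMoments f P) (hg : HasAllMoments g P) :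
    HasAllMoments (fun ω => f ω * g ω) P := fun p => by
  have : ENNReal.HolderTriple ((2 * p : ℝ≥0) : ℝ≥0∞) ((2 * p : ℝ≥0) : ℝ≥0∞) (p : ℝ≥0∞) := by
    constructor
    push_cast
    rw [ENNReal.mul_inv (by simp) (by simp), ← add_mul, ENNReal.inv_two_add_inv_two, one_mul]
  exact (hg (2 * p)).mul' (hf (2 * p))

theorem pow [IsFiniteMeasure P] (hf : HasAllMoments f P) (n : ℕ) :
    HasAllMoments (fun ω => f ω ^ n) P := by
  induction n with
  | zero => simpa using const 1
  | succ n ih => simpa only [pow_succ] using ih.mul hf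

theorem sum {κ : Type*} (s : Finset κ) {f : κ → Ω → ℝ} (hf : ∀ i ∈ s, HasAllMoments (f i) P) :
    HasAllMoments (fun ω => ∑ i ∈ s, f i ω) P :=
  fun p => memLp_finsetSum s fun i hi => hf i hi p

/-- A consequence of Fernique's theorem. -/
theorem of_hasGaussianLaw {E : Type*} [NormedAddCommGroup E] [NormedSpace ℝ E] [CompleteSpace E]
    [SecondCountableTopology E] [MeasurableSpace E] [BorelSpace E] {X : Ω → E}
    (hX : HasGaussianLaw X P) : HasAllMoments (fun ω => ‖X ω‖) P :=
  fun _ => (hX.memLp (by simp)).norm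

theorem of_hasGaussianLaw_real {X : Ω → ℝ} (hX : HasGaussianLaw X P) : HasAllMoments X P :=
  fun _ => hX.memLp (by simp)

end HasAllMoments

end AllMoments

/-! ### Moments of a centred real Gaussian -/

section GaussianMoments

/-- In Leibniz' rule only two terms survive, and at `0` one of these vanishes. -/
theorem iteratedDeriv_id_mul_zero {f : ℝ → ℝ} (hf : ContDiff ℝ ⊤ f) (n : ℕ) :
    iteratedDeriv (n + 1) (fun t => t * f t) 0 = (n + 1) * iteratedDeriv n f 0 := by
  have h : ∀ t, iteratedDeriv (n + 1) (fun t => t * f t) t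
      = t * iteratedDeriv (n + 1) f t + (n + 1) * iteratedDeriv n f t := by
    have hd : ∀ m t, HasDerivAt (iteratedDeriv m f) (iteratedDeriv (m + 1) f t) t := fun m t => by
      rw [iteratedDeriv_succ]
      exact ((hf.differentiable_iteratedDeriv m (by simp [WithTop.natCast_lt_top])) t).hasDerivAt
    induction n with
    | zero =>
      intro t
      simp only [zero_add, iteratedDeriv_one, iteratedDeriv_zero]
      have h1 := (hasDerivAt_id t).mul (hd 0 t)
      simp only [zero_add, iteratedDeriv_one, iteratedDeriv_zero] at h1
      refine Eq.trans h1.deriv ?_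
      simp; ring
    | succ n ih =>
      intro t
      rw [iteratedDeriv_succ, funext ih]
      have h1 := ((hasDerivAt_id t).mul (hd (n + 1) t)).add ((hd n t).const_mul ((n : ℝ) + 1))
      refine Eq.trans h1.deriv ?_
      simp; ring
  simp [h]

/-- The moment generating function solves `f' = v t f`; differentiating this `n + 1` times at `0`
gives the recursion. -/
theorem integral_pow_add_two_gaussianReal (v : ℝ≥0) (n : ℕ) :
    ∫ x, x ^ (n + 2) ∂gaussianReal 0 v = (n + 1) * v * ∫ x, x ^ n ∂gaussianReal 0 v := by
  have hz : (0 : ℝ) ∈ interior (integrableExpSet id (gaussianReal 0 v)) := by simp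
  have hm := iteratedDeriv_mgf_zero hz
  rw [mgf_id_gaussianReal] at hm
  simp only [zero_mul, zero_add] at hm
  set f : ℝ → ℝ := fun t => Real.exp (v * t ^ 2 / 2) with hf
  have hfc : ContDiff ℝ ⊤ f := by fun_prop
  have hd : deriv f = fun t => (v : ℝ) * (t * f t) := by
    ext t
    have h1 : HasDerivAt f (f t * (v * (2 * t) / 2)) t := by
      have := ((((hasDerivAt_id t).pow 2).const_mul (v : ℝ)).div_const 2).exp
      simpa [hf] using this
    rw [h1.deriv]; ring
  have h2 : iteratedDeriv (n + 2) f 0 = (n + 1) * v * iteratedDeriv n f 0 := by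
    rw [iteratedDeriv_succ', hd, iteratedDeriv_const_mul_field, iteratedDeriv_id_mul_zero hfc]
    ring
  rw [hm, hm] at h2
  simpa using h2

theorem integral_pow_add_two_of_hasGaussianLaw {Ω : Type*} [MeasurableSpace Ω] {P : Measure Ω}
    {Y : Ω → ℝ} (hY : HasGaussianLaw Y P) (h0 : ∫ ω, Y ω ∂P = 0) (n : ℕ) :
    ∫ ω, Y ω ^ (n + 2) ∂P = (n + 1) * (∫ ω, Y ω ^ 2 ∂P) * ∫ ω, Y ω ^ n ∂P := by
  have := hY.isProbabilityMeasure
  have hmap := hY.map_eq_gaussianReal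
  rw [h0] at hmap
  set v := (Var[Y; P]).toNNReal
  have key : ∀ k : ℕ, ∫ ω, Y ω ^ k ∂P = ∫ x, x ^ k ∂gaussianReal 0 v := fun k => by
    rw [← hmap, integral_map hY.aemeasurable (by fun_prop)]
  simp only [key]
  rw [integral_pow_add_two_gaussianReal, integral_pow_add_two_gaussianReal v 0]
  simp

end GaussianMoments

/-! ### Moments of a centred squared Gaussian -/

section CentredSquare

variable {Ω : Type*} [MeasurableSpace Ω] {P : Measure Ω} {Y : Ω → ℝ}

/-- Expand and insert the Gaussian moments `3v²`, `15v³`, `105v⁴`: for instance `8 = 15 - 9 + 3 - 1`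
and `60 = 105 - 60 + 18 - 4 + 1`. -/
theorem moments_centred_sq (hY : HasGaussianLaw Y P) (h0 : ∫ ω, Y ω ∂P = 0)
    {v : ℝ} (hv : ∫ ω, Y ω ^ 2 ∂P = v) :
    ∫ ω, (Y ω ^ 2 - v) ∂P = 0 ∧ ∫ ω, (Y ω ^ 2 - v) ^ 2 ∂P = 2 * v ^ 2 ∧
      ∫ ω, (Y ω ^ 2 - v) ^ 3 ∂P = 8 * v ^ 3 ∧ ∫ ω, (Y ω ^ 2 - v) ^ 4 ∂P = 60 * v ^ 4 := by
  have := hY.isProbabilityMeasure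
  have hm := HasAllMoments.of_hasGaussianLaw_real hY
  have hi : ∀ k : ℕ, Integrable (fun ω => Y ω ^ k) P := fun k => (hm.pow k).integrable
  have h4 := integral_pow_add_two_of_hasGaussianLaw hY h0 2
  have h6 := integral_pow_add_two_of_hasGaussianLaw hY h0 4
  have h8 := integral_pow_add_two_of_hasGaussianLaw hY h0 6
  norm_num at h4 h6 h8
  rw [h6, h4] at h8
  rw [h4] at h6
  rw [hv] at h4 h6 h8
  have e2 : ∀ ω, (Y ω ^ 2 - v) ^ 2 = Y ω ^ 4 + (-2 * v) * Y ω ^ 2 + v ^ 2 := fun ω => by ring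
  have e3 : ∀ ω, (Y ω ^ 2 - v) ^ 3
      = Y ω ^ 6 + (-3 * v) * Y ω ^ 4 + 3 * v ^ 2 * Y ω ^ 2 + (- v ^ 3) := fun ω => by ring
  have e4 : ∀ ω, (Y ω ^ 2 - v) ^ 4 = Y ω ^ 8 + (-4 * v) * Y ω ^ 6 + 6 * v ^ 2 * Y ω ^ 4
      + (-4 * v ^ 3) * Y ω ^ 2 + v ^ 4 := fun ω => by ring
  refine ⟨?_, ?_, ?_, ?_⟩
  · rw [integral_sub (hi 2) (integrable_const _), hv]; simp
  · simp only [e2]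
    rw [integral_add (by fun_prop) (by fun_prop), integral_add (by fun_prop) (by fun_prop),
      integral_const_mul, hv, h4]
    simp; ring
  · simp only [e3]
    rw [integral_add (by fun_prop) (by fun_prop), integral_add (by fun_prop) (by fun_prop),
      integral_add (by fun_prop) (by fun_prop),
      integral_const_mul, integral_const_mul, hv, h4, h6]
    simp; ring
  · simp only [e4]
    rw [integral_add (by fun_prop) (by fun_prop), integral_add (by fun_prop) (by fun_prop),
      integral_add (by fun_prop) (by fun_prop), integral_add (by fun_prop) (by fun_prop),
      integral_const_mul, integral_const_mul, integral_const_mul, hv, h4, h6, h8]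
    simp; ring

end CentredSquare

/-! ### Additivity of cumulants over independent centred variables -/

section IndependentSums

variable {Ω : Type*} [MeasurableSpace Ω] {P : Measure Ω} [IsProbabilityMeasure P]

theorem moments_add_of_indepFun {U W : Ω → ℝ} (hU : HasAllMoments U P) (hW : HasAllMoments W P)
    (h : IndepFun U W P) (hU0 : ∫ ω, U ω ∂P = 0) (hW0 : ∫ ω, W ω ∂P = 0) :
    ∫ ω, (U ω + W ω) ^ 2 ∂P = ∫ ω, U ω ^ 2 ∂P + ∫ ω, W ω ^ 2 ∂P ∧
    ∫ ω, (U ω + W ω) ^ 3 ∂P = ∫ ω, U ω ^ 3 ∂P + ∫ ω, W ω ^ 3 ∂P ∧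
    ∫ ω, (U ω + W ω) ^ 4 ∂P = ∫ ω, U ω ^ 4 ∂P + 6 * ((∫ ω, U ω ^ 2 ∂P) * ∫ ω, W ω ^ 2 ∂P)
      + ∫ ω, W ω ^ 4 ∂P := by
  have hiU : ∀ k : ℕ, Integrable (fun ω => U ω ^ k) P := fun k => (hU.pow k).integrable
  have hiW : ∀ k : ℕ, Integrable (fun ω => W ω ^ k) P := fun k => (hW.pow k).integrable
  have hi : ∀ k l : ℕ, Integrable (fun ω => U ω ^ k * W ω ^ l) P := fun k l =>
    ((hU.pow k).mul (hW.pow l)).integrable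
  have hmul : ∀ k l : ℕ, ∫ ω, U ω ^ k * W ω ^ l ∂P = (∫ ω, U ω ^ k ∂P) * ∫ ω, W ω ^ l ∂P :=
    fun k l => IndepFun.integral_fun_mul_eq_mul_integral
      (h.comp (φ := fun x => x ^ k) (ψ := fun x => x ^ l) (by fun_prop) (by fun_prop))
      (hiU k).1 (hiW l).1
  have h11 := hmul 1 1
  have h12 := hmul 1 2
  have h21 := hmul 2 1
  have h13 := hmul 1 3
  have h31 := hmul 3 1
  simp only [pow_one, hU0, hW0, zero_mul, mul_zero] at h11 h12 h21 h13 h31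
  have i11 := hi 1 1
  have i12 := hi 1 2
  have i21 := hi 2 1
  have i13 := hi 1 3
  have i31 := hi 3 1
  simp only [pow_one] at i11 i12 i21 i13 i31
  have i22 := hi 2 2
  have e2 : ∀ ω, (U ω + W ω) ^ 2 = U ω ^ 2 + 2 * (U ω * W ω) + W ω ^ 2 := fun ω => by ring
  have e3 : ∀ ω, (U ω + W ω) ^ 3
      = U ω ^ 3 + 3 * (U ω ^ 2 * W ω) + 3 * (U ω * W ω ^ 2) + W ω ^ 3 := fun ω => by ring
  have e4 : ∀ ω, (U ω + W ω) ^ 4 = U ω ^ 4 + 4 * (U ω ^ 3 * W ω) + 6 * (U ω ^ 2 * W ω ^ 2)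
      + 4 * (U ω * W ω ^ 3) + W ω ^ 4 := fun ω => by ring
  refine ⟨?_, ?_, ?_⟩
  · simp only [e2]
    rw [integral_add (by fun_prop) (by fun_prop), integral_add (by fun_prop) (by fun_prop),
      integral_const_mul, h11]
    ring
  · simp only [e3]
    rw [integral_add (by fun_prop) (by fun_prop), integral_add (by fun_prop) (by fun_prop),
      integral_add (by fun_prop) (by fun_prop), integral_const_mul, integral_const_mul, h12, h21]
    ring
  · simp only [e4]
    rw [integral_add (by fun_prop) (by fun_prop), integral_add (by fun_prop) (by fun_prop),
      integral_add (by fun_prop) (by fun_prop), integral_add (by fun_prop) (by fun_prop),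
      integral_const_mul, integral_const_mul, integral_const_mul, h13, h31, hmul 2 2]
    ring

/-- For centred variables these are the first four cumulants. Subtracting `3 m₂²` cancels the cross
term `6 E U² E W²`, the only obstruction to additivity in order four. -/
theorem moments_sum_of_iIndepFun {κ : Type*} {U : κ → Ω → ℝ} (hU : ∀ i, HasAllMoments (U i) P)
    (h : iIndepFun U P) (h0 : ∀ i, ∫ ω, U i ω ∂P = 0) (s : Finset κ) :
    ∫ ω, ∑ i ∈ s, U i ω ∂P = 0 ∧
    ∫ ω, (∑ i ∈ s, U i ω) ^ 2 ∂P = ∑ i ∈ s, ∫ ω, U i ω ^ 2 ∂P ∧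
    ∫ ω, (∑ i ∈ s, U i ω) ^ 3 ∂P = ∑ i ∈ s, ∫ ω, U i ω ^ 3 ∂P ∧
    ∫ ω, (∑ i ∈ s, U i ω) ^ 4 ∂P - 3 * (∫ ω, (∑ i ∈ s, U i ω) ^ 2 ∂P) ^ 2
      = ∑ i ∈ s, (∫ ω, U i ω ^ 4 ∂P - 3 * (∫ ω, U i ω ^ 2 ∂P) ^ 2) := by
  classical
  induction s using Finset.induction_on with
  | empty => simp
  | insert a s ha ih =>
    obtain ⟨ih1, ih2, ih3, ih4⟩ := ih
    have hs : HasAllMoments (fun ω => ∑ i ∈ s, U i ω) P := .sum s fun i _ => hU i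
    have hind : IndepFun (U a) (fun ω => ∑ i ∈ s, U i ω) P := by
      have := (h.indepFun_finsetSum_of_notMem₀ (fun i => (hU i).integrable.aemeasurable) ha).symm
      convert this using 1
      ext ω; simp
    obtain ⟨j2, j3, j4⟩ := moments_add_of_indepFun (hU a) hs hind (h0 a) ih1
    simp only [Finset.sum_insert ha]
    refine ⟨?_, ?_, ?_, ?_⟩
    · rw [integral_add (hU a).integrable hs.integrable, h0, ih1, add_zero]
    · rw [j2, ih2]
    · rw [j3, ih3]
    · rw [← ih4, j4, j2]; ring

end IndependentSums

/-! ### Cumulants of the squared norm of a Gaussian vector -/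

section QuadraticForm

open Matrix

/-- The matrix of second moments `E (X_a X_b)`. -/
noncomputable def momentMatrix {A Ω : Type*} [MeasurableSpace Ω] (X : A → Ω → ℝ)
    (P : Measure Ω) : Matrix A A ℝ :=
  Matrix.of fun a b => ∫ ω, X a ω * X b ω ∂P

theorem isHermitian_momentMatrix {A Ω : Type*} [MeasurableSpace Ω] {P : Measure Ω}
    (X : A → Ω → ℝ) : (momentMatrix X P).IsHermitian := by
  ext a b
  simp [momentMatrix, mul_comm]

variable {A : Type*} [Fintype A] [DecidableEq A]

theorem trace_pow_eq_sum_eigenvalues_pow {M : Matrix A A ℝ} (hM : M.IsHermitian) (k : ℕ) :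
    (M ^ k).trace = ∑ j, hM.eigenvalues j ^ k := by
  conv_lhs => rw [hM.spectral_theorem]
  rw [← map_pow, Unitary.conjStarAlgAut_apply, Matrix.trace_mul_comm, ← mul_assoc]
  simp [Matrix.diagonal_pow, Matrix.trace_diagonal]

variable {Ω : Type*} [MeasurableSpace Ω] {P : Measure Ω}

/-- In an eigenbasis of the covariance the coordinates are independent, so cumulants add up to power
sums of eigenvalues; `48 = 60 - 3 · 2²`. -/
theorem moments_quadratic_of_hasGaussianLaw {X : A → Ω → ℝ}
    (hX : HasGaussianLaw (fun ω a => X a ω) P) (h0 : ∀ a, ∫ ω, X a ω ∂P = 0) {W : Ω → ℝ}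
    (hW : ∀ ω, W ω = ∑ a, (X a ω ^ 2 - momentMatrix X P a a)) :
    ∫ ω, W ω ∂P = 0 ∧
    ∫ ω, W ω ^ 2 ∂P = 2 * (momentMatrix X P ^ 2).trace ∧
    ∫ ω, W ω ^ 3 ∂P = 8 * (momentMatrix X P ^ 3).trace ∧
    ∫ ω, W ω ^ 4 ∂P - 3 * (∫ ω, W ω ^ 2 ∂P) ^ 2 = 48 * (momentMatrix X P ^ 4).trace := by
  have := hX.isProbabilityMeasure
  set M := momentMatrix X P with hMdef
  have hM : M.IsHermitian := isHermitian_momentMatrix X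
  set U : Matrix A A ℝ := (hM.eigenvectorUnitary : Matrix A A ℝ) with hU
  have hUU : U * Uᵀ = 1 := by
    simpa [Matrix.star_eq_conjTranspose] using Unitary.coe_mul_star_self hM.eigenvectorUnitary
  have hdiag : Uᵀ * M * U = diagonal hM.eigenvalues := by
    have := hM.conjStarAlgAut_star_eigenvectorUnitary
    rw [Unitary.conjStarAlgAut_apply] at this
    simpa [Matrix.star_eq_conjTranspose] using this
  let Y : A → Ω → ℝ := fun j ω => ∑ a, U a j * X a ω
  have hXm : ∀ a, HasAllMoments (X a) P := fun a => .of_hasGaussianLaw_real (hX.eval a)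
  have hYX : ∀ ω, (fun j => Y j ω) = Uᵀ *ᵥ (fun a => X a ω) := fun ω => rfl
  have hY : HasGaussianLaw (fun ω j => Y j ω) P :=
    hX.map_fun (Matrix.toLin' Uᵀ).toContinuousLinearMap
  have hYm : ∀ j, HasAllMoments (Y j) P := fun j => .of_hasGaussianLaw_real (hY.eval j)
  have hY0 : ∀ j, ∫ ω, Y j ω ∂P = 0 := fun j => by
    simp only [Y]
    rw [integral_finsetSum _ fun a _ => ((hXm a).const_mul _).integrable]
    simp [integral_const_mul, h0]
  have hYY : ∀ i j, ∫ ω, Y i ω * Y j ω ∂P = diagonal hM.eigenvalues i j := fun i j => by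
    have e : ∀ ω, Y i ω * Y j ω = ∑ a, ∑ b, U a i * U b j * (X a ω * X b ω) := fun ω => by
      simp only [Y, Finset.sum_mul_sum]
      exact Finset.sum_congr rfl fun a _ => Finset.sum_congr rfl fun b _ => by ring
    have hint : ∀ a b, HasAllMoments (fun ω => U a i * U b j * (X a ω * X b ω)) P := fun a b =>
      ((hXm a).mul (hXm b)).const_mul _
    simp only [e]
    rw [integral_finsetSum _ fun a _ => (HasAllMoments.sum _ fun b _ => hint a b).integrable]
    simp_rw [integral_finsetSum _ fun b _ => (hint _ b).integrable, integral_const_mul]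
    rw [← hdiag, Matrix.mul_apply]
    simp only [Matrix.mul_apply, Matrix.transpose_apply, Finset.sum_mul, hMdef, momentMatrix,
      Matrix.of_apply]
    rw [Finset.sum_comm]
    exact Finset.sum_congr rfl fun a _ => Finset.sum_congr rfl fun b _ => by ring
  -- Jointly Gaussian and uncorrelated implies independent.
  have hind : iIndepFun Y P := by
    refine hY.iIndepFun_of_covariance_eq_zero fun i j hij => ?_
    rw [covariance_eq_sub ((hYm i).memLp (by simp)) ((hYm j).memLp (by simp)), hY0, zero_mul,
      sub_zero]
    simpa [hij] using hYY i j
  have hYv : ∀ j, ∫ ω, Y j ω ^ 2 ∂P = hM.eigenvalues j := fun j => by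
    simpa [sq] using hYY j j
  have hsq : ∀ ω, ∑ a, X a ω ^ 2 = ∑ j, Y j ω ^ 2 := fun ω => by
    have : (fun j => Y j ω) ⬝ᵥ (fun j => Y j ω) = (fun a => X a ω) ⬝ᵥ (fun a => X a ω) := by
      rw [hYX, Matrix.dotProduct_mulVec, Matrix.vecMul_transpose, Matrix.mulVec_mulVec, hUU,
        Matrix.one_mulVec]
    simpa [dotProduct, sq] using this.symm
  have htr := trace_pow_eq_sum_eigenvalues_pow hM
  have hWY : ∀ ω, W ω = ∑ j, (Y j ω ^ 2 - hM.eigenvalues j) := fun ω => by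
    rw [hW, Finset.sum_sub_distrib, Finset.sum_sub_distrib, hsq]
    have := htr 1
    simp only [pow_one, Matrix.trace, Matrix.diag] at this
    rw [this]
  have hmom := fun j => moments_centred_sq (hY.eval j) (hY0 j) (hYv j)
  have hUm : ∀ j, HasAllMoments (fun ω => Y j ω ^ 2 - hM.eigenvalues j) P := fun j =>
    ((hYm j).pow 2).sub (.const _)
  obtain ⟨m1, m2, m3, m4⟩ := moments_sum_of_iIndepFun hUm
    (hind.comp (fun j x => x ^ 2 - hM.eigenvalues j) fun j => by fun_prop)
    (fun j => (hmom j).1) Finset.univ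
  simp only [← hWY] at m1 m2 m3 m4
  refine ⟨m1, ?_, ?_, ?_⟩
  · rw [m2, htr, Finset.mul_sum]
    exact Finset.sum_congr rfl fun j _ => (hmom j).2.1
  · rw [m3, htr, Finset.mul_sum]
    exact Finset.sum_congr rfl fun j _ => (hmom j).2.2.1
  · rw [m4, htr, Finset.mul_sum]
    refine Finset.sum_congr rfl fun j _ => ?_
    rw [(hmom j).2.1, (hmom j).2.2.2]
    ring

end QuadraticForm

/-! ### Traces of powers of block matrices -/

section TraceBounds

open Matrix

variable {I S : Type*} [Fintype I] [Fintype S]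

attribute [local instance] Matrix.frobeniusNormedAddCommGroup Matrix.frobeniusNormedSpace


theorem frobenius_norm_eq_sqrt (B : Matrix S S ℝ) : ‖B‖ = √(∑ k, ∑ l, B k l ^ 2) := by
  simp [Matrix.frobenius_norm_def, Real.sqrt_eq_rpow]

theorem trace_mul_le_frobenius (B C : Matrix S S ℝ) : (B * C).trace ≤ ‖B‖ * ‖C‖ := by
  rw [← Matrix.frobenius_norm_transpose C, frobenius_norm_eq_sqrt, frobenius_norm_eq_sqrt]
  have := Real.sum_mul_le_sqrt_mul_sqrt (Finset.univ : Finset (S × S)) (fun p => B p.1 p.2)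
    (fun p => C p.2 p.1)
  simpa [Matrix.trace, Matrix.mul_apply, Fintype.sum_prod_type] using this

/-- The block with index `(i, j)` of a matrix on `I × S`. -/
def block {I S : Type*} (M : Matrix (I × S) (I × S) ℝ) (i j : I) : Matrix S S ℝ :=
  Matrix.of fun k l => M (i, k) (j, l)

theorem block_mul (M N : Matrix (I × S) (I × S) ℝ) (i l : I) :
    block (M * N) i l = ∑ j, block M i j * block N j l := by
  ext k m
  simp [block, Matrix.mul_apply, Matrix.sum_apply, Fintype.sum_prod_type]

theorem trace_eq_sum_block (M : Matrix (I × S) (I × S) ℝ) :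
    M.trace = ∑ i, (block M i i).trace := by
  simp [block, Matrix.trace, Fintype.sum_prod_type]

variable [DecidableEq I] [DecidableEq S]

/-- The trace is a sum over closed walks of traces of block products; Cauchy-Schwarz splits off the
last block and submultiplicativity of the Frobenius norm handles the rest. -/
theorem trace_pow_three_le (M : Matrix (I × S) (I × S) ℝ) {h : I → I → ℝ}
    (hh : ∀ i j, √(∑ k, ∑ l, M (i, k) (j, l) ^ 2) ≤ h i j) :
    (M ^ 3).trace ≤ ∑ i, ∑ j, ∑ l, h i l * h l j * h j i := by
  have hB : ∀ i j, ‖block M i j‖ ≤ h i j := fun i j => by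
    rw [frobenius_norm_eq_sqrt]; exact hh i j
  have hn : ∀ i j, 0 ≤ h i j := fun i j => (norm_nonneg _).trans (hB i j)
  simp only [pow_succ, pow_zero, one_mul, trace_eq_sum_block, block_mul, Matrix.trace_sum,
    Finset.sum_mul]
  gcongr with i _ j _ l _
  refine (trace_mul_le_frobenius _ _).trans (mul_le_mul ((Matrix.frobenius_norm_mul _ _).trans
    (mul_le_mul (hB _ _) (hB _ _) (norm_nonneg _) (hn _ _))) (hB _ _) (norm_nonneg _)
    (mul_nonneg (hn _ _) (hn _ _)))

theorem trace_pow_four_le (M : Matrix (I × S) (I × S) ℝ) {h : I → I → ℝ}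
    (hh : ∀ i j, √(∑ k, ∑ l, M (i, k) (j, l) ^ 2) ≤ h i j) :
    (M ^ 4).trace ≤ ∑ i, ∑ j, ∑ l, ∑ m, h i m * h m l * h l j * h j i := by
  have hB : ∀ i j, ‖block M i j‖ ≤ h i j := fun i j => by
    rw [frobenius_norm_eq_sqrt]; exact hh i j
  have hn : ∀ i j, 0 ≤ h i j := fun i j => (norm_nonneg _).trans (hB i j)
  simp only [pow_succ, pow_zero, one_mul, trace_eq_sum_block, block_mul, Matrix.trace_sum,
    Finset.sum_mul]
  gcongr with i _ j _ l _ m _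
  refine (trace_mul_le_frobenius _ _).trans (mul_le_mul ((Matrix.frobenius_norm_mul _ _).trans
    (mul_le_mul ((Matrix.frobenius_norm_mul _ _).trans
      (mul_le_mul (hB _ _) (hB _ _) (norm_nonneg _) (hn _ _))) (hB _ _) (norm_nonneg _)
      (mul_nonneg (hn _ _) (hn _ _)))) (hB _ _) (norm_nonneg _)
    (mul_nonneg (mul_nonneg (hn _ _) (hn _ _)) (hn _ _)))

end TraceBounds

/-! ### Cyclic sums bounded by path sums -/

section CyclicSums

variable {I : Type*} [Fintype I] {g : I → I → ℝ} {A : ℝ}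

theorem sum_path_two_le (hg : ∀ i j, 0 ≤ g i j) (hA : ∀ i, ∑ j, g i j ≤ A) :
    ∑ i, ∑ j, ∑ k, g i j * g j k ≤ Fintype.card I * A ^ 2 := by
  calc ∑ i, ∑ j, ∑ k, g i j * g j k = ∑ i, ∑ j, g i j * ∑ k, g j k := by
        simp only [Finset.mul_sum]
    _ ≤ ∑ i, ∑ j, g i j * A := by
        gcongr with i _ j _
        · exact hg i j
        · exact hA j
    _ = ∑ i, (∑ j, g i j) * A := by simp only [Finset.sum_mul]
    _ ≤ ∑ i : I, A * A := by
        gcongr with i _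
        · exact (Finset.sum_nonneg fun j _ => hg i j).trans (hA i)
        · exact hA i
    _ = _ := by simp [sq]

theorem sum_path_three_le (hg : ∀ i j, 0 ≤ g i j) (hA : ∀ i, ∑ j, g i j ≤ A) :
    ∑ i, ∑ j, ∑ k, ∑ l, g i j * g j k * g k l ≤ Fintype.card I * A ^ 3 := by
  rcases isEmpty_or_nonempty I with hI | ⟨⟨i₀⟩⟩
  · simp
  have hA0 : 0 ≤ A := (Finset.sum_nonneg fun j _ => hg i₀ j).trans (hA i₀)
  calc ∑ i, ∑ j, ∑ k, ∑ l, g i j * g j k * g k l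
      = ∑ i, ∑ j, ∑ k, g i j * g j k * ∑ l, g k l := by simp only [Finset.mul_sum]
    _ ≤ ∑ i, ∑ j, ∑ k, g i j * g j k * A := by
        gcongr with i _ j _ k _
        · exact mul_nonneg (hg i j) (hg j k)
        · exact hA k
    _ = (∑ i, ∑ j, ∑ k, g i j * g j k) * A := by simp only [Finset.sum_mul]
    _ ≤ Fintype.card I * A ^ 2 * A := by
        gcongr
        exact sum_path_two_le hg hA
    _ = _ := by ring

/-- AM-GM for `xy`, `yz`, `zx`. Integer powers are kept by letting `x`, `y`, `z` stand for square
roots of the actual weights. -/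
theorem mul_three_le_pow {x y z : ℝ} (hx : 0 ≤ x) (hy : 0 ≤ y) (hz : 0 ≤ z) :
    x ^ 2 * y ^ 2 * z ^ 2 ≤ (x ^ 3 * y ^ 3 + y ^ 3 * z ^ 3 + z ^ 3 * x ^ 3) / 3 := by
  have key : ∀ u v w : ℝ, 0 ≤ u → 0 ≤ v → 0 ≤ w → u * v * w ≤ (u ^ 3 + v ^ 3 + w ^ 3) / 3 :=
    fun u v w hu hv hw => by
      -- `u³ + v³ + w³ - 3uvw` is half the product supplied here.
      nlinarith [mul_nonneg (add_nonneg (add_nonneg hu hv) hw) (add_nonneg (add_nonneg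
        (sq_nonneg (u - v)) (sq_nonneg (v - w))) (sq_nonneg (w - u)))]
  have := key (x * y) (y * z) (z * x) (by positivity) (by positivity) (by positivity)
  calc _ = x * y * (y * z) * (z * x) := by ring
    _ ≤ _ := this
    _ = _ := by ring

theorem mul_four_le_pow (x y z w : ℝ) :
    x ^ 3 * y ^ 3 * z ^ 3 * w ^ 3 ≤ (x ^ 4 * y ^ 4 * z ^ 4 + y ^ 4 * z ^ 4 * w ^ 4
      + z ^ 4 * w ^ 4 * x ^ 4 + w ^ 4 * x ^ 4 * y ^ 4) / 4 := by
  have key : ∀ a b c d : ℝ, a * b * c * d ≤ (a ^ 4 + b ^ 4 + c ^ 4 + d ^ 4) / 4 :=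
    fun a b c d => by
      -- `a⁴ + b⁴ + c⁴ + d⁴ - 4abcd = (a² - b²)² + (c² - d²)² + 2(ab - cd)²`.
      nlinarith [sq_nonneg (a * b - c * d), sq_nonneg (a ^ 2 - b ^ 2), sq_nonneg (c ^ 2 - d ^ 2)]
  have := key (x * y * z) (y * z * w) (z * w * x) (w * x * y)
  calc _ = x * y * z * (y * z * w) * (z * w * x) * (w * x * y) := by ring
    _ ≤ _ := this
    _ = _ := by ring

/-- Removing any edge of a directed triangle leaves a directed path, so row sums suffice and `g`
need not be symmetric. -/
theorem sum_cycle_three_le (hg : ∀ i j, 0 ≤ g i j) (hA : ∀ i, ∑ j, g i j ^ 3 ≤ A) :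
    ∑ i, ∑ j, ∑ k, g i k ^ 2 * g k j ^ 2 * g j i ^ 2 ≤ Fintype.card I * A ^ 2 := by
  have hp := sum_path_two_le (fun i j => pow_nonneg (hg i j) 3) hA
  have h1 : ∑ i, ∑ j, ∑ k, g i k ^ 3 * g k j ^ 3 ≤ Fintype.card I * A ^ 2 := by
    refine le_of_eq_of_le (Finset.sum_congr rfl fun i _ => ?_) hp
    rw [Finset.sum_comm]
  have h2 : ∑ i, ∑ j, ∑ k, g k j ^ 3 * g j i ^ 3 ≤ Fintype.card I * A ^ 2 := by
    refine le_of_eq_of_le ?_ h1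
    rw [Finset.sum_comm_cycle]
  have h3 : ∑ i, ∑ j, ∑ k, g j i ^ 3 * g i k ^ 3 ≤ Fintype.card I * A ^ 2 := by
    refine le_of_eq_of_le ?_ hp
    rw [Finset.sum_comm]
  calc _ ≤ ∑ i, ∑ j, ∑ k, (g i k ^ 3 * g k j ^ 3 + g k j ^ 3 * g j i ^ 3
        + g j i ^ 3 * g i k ^ 3) / 3 := by
        gcongr with i _ j _ k _
        exact mul_three_le_pow (hg _ _) (hg _ _) (hg _ _)
    _ ≤ _ := by
        simp only [← Finset.sum_div, Finset.sum_add_distrib]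
        linarith

theorem sum_cycle_four_le (hA : ∀ i, ∑ j, g i j ^ 4 ≤ A) :
    ∑ i, ∑ j, ∑ k, ∑ l, g i l ^ 3 * g l k ^ 3 * g k j ^ 3 * g j i ^ 3
      ≤ Fintype.card I * A ^ 3 := by
  have hp := sum_path_three_le (fun i j => (by positivity : 0 ≤ g i j ^ 4)) hA
  have h1 : ∑ i, ∑ j, ∑ k, ∑ l, g i l ^ 4 * g l k ^ 4 * g k j ^ 4 ≤ Fintype.card I * A ^ 3 := by
    refine le_of_eq_of_le (Finset.sum_congr rfl fun i _ => ?_) hp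
    rw [Finset.sum_comm_cycle]
    exact Finset.sum_congr rfl fun l _ => Finset.sum_comm
  have h2 : ∑ i, ∑ j, ∑ k, ∑ l, g l k ^ 4 * g k j ^ 4 * g j i ^ 4 ≤ Fintype.card I * A ^ 3 := by
    refine le_of_eq_of_le ?_ hp
    rw [Finset.sum_comm_cycle]
    refine Eq.trans (Finset.sum_congr rfl fun k _ => Finset.sum_comm_cycle) ?_
    rw [Finset.sum_comm]
    exact Finset.sum_congr rfl fun l _ => Finset.sum_congr rfl fun k _ => Finset.sum_comm
  have h3 : ∑ i, ∑ j, ∑ k, ∑ l, g k j ^ 4 * g j i ^ 4 * g i l ^ 4 ≤ Fintype.card I * A ^ 3 := by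
    refine le_of_eq_of_le ?_ hp
    rw [Finset.sum_comm_cycle]
    exact Finset.sum_congr rfl fun k _ => Finset.sum_comm
  have h4 : ∑ i, ∑ j, ∑ k, ∑ l, g j i ^ 4 * g i l ^ 4 * g l k ^ 4 ≤ Fintype.card I * A ^ 3 := by
    refine le_of_eq_of_le ?_ hp
    rw [Finset.sum_comm]
    exact Finset.sum_congr rfl fun j _ => Finset.sum_congr rfl fun i _ => Finset.sum_comm
  calc _ ≤ ∑ i, ∑ j, ∑ k, ∑ l, (g i l ^ 4 * g l k ^ 4 * g k j ^ 4
        + g l k ^ 4 * g k j ^ 4 * g j i ^ 4 + g k j ^ 4 * g j i ^ 4 * g i l ^ 4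
        + g j i ^ 4 * g i l ^ 4 * g l k ^ 4) / 4 := by
        gcongr with i _ j _ k _ l _
        exact mul_four_le_pow _ _ _ _
    _ ≤ _ := by
        simp only [← Finset.sum_div, Finset.sum_add_distrib]
        linarith

end CyclicSums

/-! ### Toeplitz weights `q(i - j)` -/

section Toeplitz

variable {n : ℕ} {q : ℤ → ℝ}

/-- For fixed `i` the differences `i - j` are distinct and smaller than `n` in absolute value. -/
theorem sum_sub_le_sum_Ioo (hq : ∀ i, 0 ≤ q i) (i : Finset.Icc (1 : ℤ) n) :
    ∑ j : Finset.Icc (1 : ℤ) n, q (i - j) ≤ ∑ k ∈ Finset.Ioo (-(n : ℤ)) n, q k := by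
  rw [Finset.sum_coe_sort (Finset.Icc (1 : ℤ) n) fun j => q (i - j)]
  rw [← Finset.sum_image (g := fun j => (i : ℤ) - j) (f := q) fun a _ b _ h => by simpa using h]
  refine Finset.sum_le_sum_of_subset_of_nonneg ?_ fun k _ _ => hq k
  intro k hk
  obtain ⟨j, hj, rfl⟩ := Finset.mem_image.1 hk
  have hi := Finset.mem_Icc.1 i.2
  rw [Finset.mem_Icc] at hj
  rw [Finset.mem_Ioo]
  omega

theorem sum_toeplitz_three_le (hq : ∀ i, 0 ≤ q i) :
    ∑ i : Finset.Icc (1 : ℤ) n, ∑ j : Finset.Icc (1 : ℤ) n, ∑ k : Finset.Icc (1 : ℤ) n,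
      q (i - k) * q (k - j) * q (j - i)
      ≤ n * (∑ k ∈ Finset.Ioo (-(n : ℤ)) n, q k ^ (3 / 2 : ℝ)) ^ 2 := by
  have e2 : ∀ i, (q i ^ (1 / 2 : ℝ)) ^ 2 = q i := fun i => by
    rw [← Real.rpow_mul_natCast (hq i)]; norm_num
  have e3 : ∀ i, (q i ^ (1 / 2 : ℝ)) ^ 3 = q i ^ (3 / 2 : ℝ) := fun i => by
    rw [← Real.rpow_mul_natCast (hq i)]; norm_num
  have := sum_cycle_three_le (I := Finset.Icc (1 : ℤ) n)
    (g := fun i j => q (i - j) ^ (1 / 2 : ℝ)) (fun i j => Real.rpow_nonneg (hq _) _) fun i => by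
      simp only [e3]
      exact sum_sub_le_sum_Ioo (q := fun i => q i ^ (3 / 2 : ℝ))
        (fun i => Real.rpow_nonneg (hq _) _) i
  simp only [e2] at this
  simpa using this

theorem sum_toeplitz_four_le (hq : ∀ i, 0 ≤ q i) :
    ∑ i : Finset.Icc (1 : ℤ) n, ∑ j : Finset.Icc (1 : ℤ) n, ∑ k : Finset.Icc (1 : ℤ) n,
      ∑ l : Finset.Icc (1 : ℤ) n, q (i - l) * q (l - k) * q (k - j) * q (j - i)
      ≤ n * (∑ k ∈ Finset.Ioo (-(n : ℤ)) n, q k ^ (4 / 3 : ℝ)) ^ 3 := by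
  have e3 : ∀ i, (q i ^ (1 / 3 : ℝ)) ^ 3 = q i := fun i => by
    rw [← Real.rpow_mul_natCast (hq i)]; norm_num
  have e4 : ∀ i, (q i ^ (1 / 3 : ℝ)) ^ 4 = q i ^ (4 / 3 : ℝ) := fun i => by
    rw [← Real.rpow_mul_natCast (hq i)]; norm_num
  have := sum_cycle_four_le (I := Finset.Icc (1 : ℤ) n)
    (g := fun i j => q (i - j) ^ (1 / 3 : ℝ)) fun i => by
      simp only [e4]
      exact sum_sub_le_sum_Ioo (q := fun i => q i ^ (4 / 3 : ℝ))
        (fun i => Real.rpow_nonneg (hq _) _) i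
  simp only [e3] at this
  simpa using this

end Toeplitz

open Filter Topology

/-! ### Hilbert bases and Hilbert-Schmidt norms -/

section HilbertBases

variable {V : Type*} [NormedAddCommGroup V] [InnerProductSpace ℝ V] {ι : Type*}

theorem sum_inner_sq_le (e : HilbertBasis ι ℝ V) (S : Finset ι) (x : V) :
    ∑ k ∈ S, inner ℝ x (e k) ^ 2 ≤ ‖x‖ ^ 2 := by
  simpa [real_inner_comm] using e.orthonormal.sum_inner_products_le x (s := S)

theorem hasSum_inner_sq [CompleteSpace V] (e : HilbertBasis ι ℝ V) (x : V) :
    HasSum (fun k => inner ℝ x (e k) ^ 2) (‖x‖ ^ 2) := by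
  have := e.hasSum_inner_mul_inner x x
  simpa [real_inner_comm, sq] using this

/-- Basis vectors are `√2` apart, so the balls of radius `1/2` around them are disjoint open sets in
a separable space. -/
theorem countable_of_hilbertBasis [TopologicalSpace.SeparableSpace V] (e : HilbertBasis ι ℝ V) :
    Countable ι := by
  have hd : ∀ i j, i ≠ j → 1 ≤ dist (e i) (e j) := fun i j hij => by
    have h1 := e.orthonormal.1
    have : ‖e i - e j‖ ^ 2 = 2 := by
      rw [norm_sub_sq_real, h1, h1, e.orthonormal.2 hij]; norm_num
    rw [dist_eq_norm]
    nlinarith [norm_nonneg (e i - e j)]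
  have hdisj : Pairwise (Function.onFun Disjoint fun i => Metric.ball (e i) (1 / 2)) :=
    fun i j hij => Metric.ball_disjoint_ball (by norm_num; exact hd i j hij)
  exact hdisj.countable_of_isOpen_disjoint (fun i => Metric.isOpen_ball)
    fun i => ⟨e i, Metric.mem_ball_self (by norm_num)⟩

theorem sqrt_sum_inner_sq_le_hsNorm (e : HilbertBasis ι ℝ V) {T : V →L[ℝ] V}
    (hT : IsHilbertSchmidt e T) (S : Finset ι) :
    √(∑ k : S, ∑ l : S, inner ℝ (T (e k)) (e l) ^ 2) ≤ hsNorm e T := by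
  refine Real.sqrt_le_sqrt ?_
  calc ∑ k : S, ∑ l : S, inner ℝ (T (e k)) (e l) ^ 2
      = ∑ k ∈ S, ∑ l ∈ S, inner ℝ (T (e k)) (e l) ^ 2 := by
        rw [← Finset.sum_coe_sort S fun k => ∑ l ∈ S, inner ℝ (T (e k)) (e l) ^ 2]
        exact Finset.sum_congr rfl fun k _ =>
          Finset.sum_coe_sort S fun l => inner ℝ (T (e k)) (e l) ^ 2
    _ ≤ ∑ k ∈ S, ‖T (e k)‖ ^ 2 := Finset.sum_le_sum fun k _ => sum_inner_sq_le e S _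
    _ ≤ _ := hT.sum_le_tsum S fun k _ => by positivity

end HilbertBases

/-! ### Auto-covariance operators of the Gaussian sequence -/

section Sequence

variable {V : Type*} [NormedAddCommGroup V] [InnerProductSpace ℝ V]
  [MeasurableSpace V] [BorelSpace V] {ι : Type*} (e : HilbertBasis ι ℝ V)
  {Ω : Type*} [MeasurableSpace Ω] {P : Measure Ω} {Z : ℤ → Ω → V}

theorem hasAllMoments_inner (hZ : IsGaussianProcess Z P) (i : ℤ) (v : V) :
    HasAllMoments (fun ω => inner ℝ (Z i ω) v) P := by
  have := HasAllMoments.of_hasGaussianLaw_real ((hZ.hasGaussianLaw_eval i).map_fun (innerSL ℝ v))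
  simpa [real_inner_comm] using this

variable [SecondCountableTopology V]

theorem isGaussianProcess_coord (hZ : IsGaussianProcess Z P) :
    IsGaussianProcess (fun (p : ℤ × ι) ω => inner ℝ (Z p.1 ω) (e p.2)) P := by
  have := (hZ.comp_right (Prod.fst : ℤ × ι → ℤ)).comp_left fun p => innerSL ℝ (e p.2)
  simpa [real_inner_comm] using this

variable [CompleteSpace V]

variable (hZ : IsGaussianProcess Z P) (hZ0 : ∀ i, ∫ ω, Z i ω ∂P = 0) (hstat : IsStationary Z P)

include hZ hZ0 hstat

theorem integral_inner_mul_inner (i j : ℤ) (v w : V) :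
    ∫ ω, inner ℝ (Z i ω) v * inner ℝ (Z j ω) w ∂P = inner ℝ (autoCov Z P (i - j) v) w :=
  (inner_autoCov (fun i => (hZ.hasGaussianLaw_eval i).memLp_two) hZ0 hstat i j v w).symm

theorem integral_inner_sq (i : ℤ) (v : V) :
    ∫ ω, inner ℝ (Z i ω) v ^ 2 ∂P = inner ℝ (autoCov Z P 0 v) v := by
  simpa [sq] using integral_inner_mul_inner hZ hZ0 hstat i i v v

theorem inner_autoCov_zero_nonneg (v : V) : 0 ≤ inner ℝ (autoCov Z P 0 v) v := by
  rw [← integral_inner_sq hZ hZ0 hstat 0]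
  exact integral_nonneg fun ω => sq_nonneg _

/-- With `w = Q(i) v`, `‖w‖² = E ⟨Z_i, v⟩⟨Z_0, w⟩`; a weighted AM-GM bounds this by `⟨Qv, v⟩` and
`⟨Qw, w⟩ ≤ K ‖w‖²`, and the latter is absorbed. Summed over a basis this gives the Hilbert-Schmidt
property; for `i = 0` it shows that `Q` vanishes wherever its quadratic form does. -/
theorem norm_autoCov_sq_le (i : ℤ) (v : V) :
    ‖autoCov Z P i v‖ ^ 2 ≤ (‖autoCov Z P 0‖ + 1) * inner ℝ (autoCov Z P 0 v) v := by
  have := hZ.isProbabilityMeasure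
  -- The added `1` makes `K` positive, so that it can be cancelled at the end.
  set K := ‖autoCov Z P 0‖ + 1
  have hK : 0 < K := by positivity
  set w := autoCov Z P i v with hw
  have hv := hasAllMoments_inner hZ i v
  have hw' := hasAllMoments_inner hZ 0 w
  have h1 : ∫ ω, 2 * K * (inner ℝ (Z i ω) v * inner ℝ (Z 0 ω) w) ∂P
      ≤ ∫ ω, (K ^ 2 * inner ℝ (Z i ω) v ^ 2 + inner ℝ (Z 0 ω) w ^ 2) ∂P := by
    refine integral_mono ((hv.mul hw').const_mul _).integrable
      (((hv.pow 2).const_mul _).add (hw'.pow 2)).integrable fun ω => ?_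
    have := sq_nonneg (K * inner ℝ (Z i ω) v - inner ℝ (Z 0 ω) w)
    dsimp only
    linarith
  rw [integral_const_mul, integral_inner_mul_inner hZ hZ0 hstat,
    integral_add ((hv.pow 2).const_mul _).integrable (hw'.pow 2).integrable, integral_const_mul,
    integral_inner_sq hZ hZ0 hstat, integral_inner_sq hZ hZ0 hstat, sub_zero, ← hw,
    real_inner_self_eq_norm_sq] at h1
  have h2 : inner ℝ (autoCov Z P 0 w) w ≤ K * ‖w‖ ^ 2 := by
    have h3 := (real_inner_le_norm (autoCov Z P 0 w) w).trans
      (mul_le_mul_of_nonneg_right ((autoCov Z P 0).le_opNorm w) (norm_nonneg w))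
    nlinarith [sq_nonneg ‖w‖]
  have h4 : K * ‖w‖ ^ 2 ≤ K * (K * inner ℝ (autoCov Z P 0 v) v) := by nlinarith
  exact le_of_mul_le_mul_left h4 hK

/-- By Bessel's inequality the partial sums are at most `E ‖Z_0‖²`. -/
theorem hasTrace_autoCov_zero : HasTrace e (autoCov Z P 0) := by
  have := hZ.isProbabilityMeasure
  refine summable_of_sum_le (c := ∫ ω, ‖Z 0 ω‖ ^ 2 ∂P)
    (fun k => inner_autoCov_zero_nonneg hZ hZ0 hstat _) fun S => ?_
  simp_rw [← integral_inner_sq hZ hZ0 hstat 0]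
  rw [← integral_finsetSum _ fun k _ => ((hasAllMoments_inner hZ 0 (e k)).pow 2).integrable]
  exact integral_mono
    (HasAllMoments.sum S fun k _ => (hasAllMoments_inner hZ 0 (e k)).pow 2).integrable
    ((HasAllMoments.of_hasGaussianLaw (hZ.hasGaussianLaw_eval 0)).pow 2).integrable
    fun ω => sum_inner_sq_le e S _

theorem isHilbertSchmidt_autoCov (i : ℤ) : IsHilbertSchmidt e (autoCov Z P i) :=
  Summable.of_nonneg_of_le (fun _ => by positivity)
    (fun _ => norm_autoCov_sq_le hZ hZ0 hstat i _)
    (Summable.mul_left _ (hasTrace_autoCov_zero e hZ hZ0 hstat))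

theorem exists_inner_autoCov_zero_ne_zero (hQ : autoCov Z P 0 ≠ 0) :
    ∃ k, inner ℝ (autoCov Z P 0 (e k)) (e k) ≠ 0 := by
  by_contra! h
  refine hQ (ContinuousLinearMap.ext_on (s := Set.range e) ?_ ?_)
  · rw [Submodule.dense_iff_topologicalClosure_eq_top]
    exact e.dense_span
  · rintro _ ⟨k, rfl⟩
    have := norm_autoCov_sq_le hZ hZ0 hstat 0 (e k)
    rw [h k, mul_zero] at this
    simpa using pow_eq_zero_iff (two_ne_zero) |>.1 (le_antisymm this (sq_nonneg _))

end Sequence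

/-! ### Truncation to finitely many coordinates and passage to the limit -/

section Truncation

variable {V : Type*} [NormedAddCommGroup V] [InnerProductSpace ℝ V] {ι : Type*}
  {Ω : Type*} [MeasurableSpace Ω]

/-- The centred sum of squares of the coordinates in `S` of `Z_1, …, Z_n`. -/
noncomputable def truncSum (e : HilbertBasis ι ℝ V) (Z : ℤ → Ω → V) (P : Measure Ω) (n : ℕ)
    (S : Finset ι) (ω : Ω) : ℝ :=
  ∑ i ∈ Finset.Icc (1 : ℤ) n, ∑ k ∈ S,
    (inner ℝ (Z i ω) (e k) ^ 2 - inner ℝ (autoCov Z P 0 (e k)) (e k))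

/-- The centred sum `∑ (‖Z_i‖² - Tr Q)` over `1 ≤ i ≤ n`. -/
noncomputable def fullSum (e : HilbertBasis ι ℝ V) (Z : ℤ → Ω → V) (P : Measure Ω) (n : ℕ)
    (ω : Ω) : ℝ :=
  ∑ i ∈ Finset.Icc (1 : ℤ) n, (‖Z i ω‖ ^ 2 - trace e (autoCov Z P 0))

variable [CompleteSpace V]
  [SecondCountableTopology V] [MeasurableSpace V] [BorelSpace V]
  (e : HilbertBasis ι ℝ V) {P : Measure Ω} {Z : ℤ → Ω → V}
  (hZ : IsGaussianProcess Z P) (hZ0 : ∀ i, ∫ ω, Z i ω ∂P = 0) (hstat : IsStationary Z P)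

theorem hasAllMoments_fullSum (hZ : IsGaussianProcess Z P) (n : ℕ) :
    HasAllMoments (fullSum e Z P n) P := by
  have := hZ.isProbabilityMeasure
  exact .sum _ fun i _ =>
    ((HasAllMoments.of_hasGaussianLaw (hZ.hasGaussianLaw_eval i)).pow 2).sub (.const _)

include hZ hZ0 hstat

/-- Dominated convergence; countability of `ι` makes the filter of finite subsets countably
generated. -/
theorem tendsto_integral_truncSum_pow [Countable ι] (n m : ℕ) :
    Tendsto (fun S => ∫ ω, truncSum e Z P n S ω ^ m ∂P) atTop
      (𝓝 (∫ ω, fullSum e Z P n ω ^ m ∂P)) := by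
  have := hZ.isProbabilityMeasure
  have htr := hasTrace_autoCov_zero e hZ hZ0 hstat
  have hnn := fun k => inner_autoCov_zero_nonneg hZ hZ0 hstat (e k)
  have htm : ∀ S, HasAllMoments (truncSum e Z P n S) P := fun S =>
    .sum _ fun i _ => .sum _ fun k _ => ((hasAllMoments_inner hZ i (e k)).pow 2).sub (.const _)
  -- The dominating function: it bounds every truncated sum, uniformly in `S`.
  have hG : HasAllMoments (fun ω => ∑ i ∈ Finset.Icc (1 : ℤ) n,
      (‖Z i ω‖ ^ 2 + trace e (autoCov Z P 0))) P := .sum _ fun i _ =>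
    ((HasAllMoments.of_hasGaussianLaw (hZ.hasGaussianLaw_eval i)).pow 2).add (.const _)
  refine tendsto_integral_filter_of_dominated_convergence _
    (Eventually.of_forall fun S => ((htm S).pow m).integrable.1)
    (Eventually.of_forall fun S => Eventually.of_forall fun ω => ?_) (hG.pow m).integrable
    (Eventually.of_forall fun ω => ?_)
  · rw [norm_pow]
    refine pow_le_pow_left₀ (norm_nonneg _) ((norm_sum_le _ _).trans ?_) m
    refine Finset.sum_le_sum fun i _ => ?_
    rw [Finset.sum_sub_distrib]
    refine (norm_sub_le _ _).trans (add_le_add ?_ ?_)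
    · rw [Real.norm_of_nonneg (Finset.sum_nonneg fun k _ => sq_nonneg _)]
      exact sum_inner_sq_le e S _
    · rw [Real.norm_of_nonneg (Finset.sum_nonneg fun k _ => hnn k)]
      exact htr.sum_le_tsum S fun k _ => hnn k
  · refine Tendsto.pow (tendsto_finsetSum _ fun i _ => ?_) m
    exact (hasSum_inner_sq e (Z i ω)).sub htr.hasSum

theorem moments_truncSum_le (n : ℕ) (S : Finset ι) :
    ∫ ω, truncSum e Z P n S ω ∂P = 0 ∧
    (1 ≤ n → ∀ k ∈ S, 2 * inner ℝ (autoCov Z P 0 (e k)) (e k) ^ 2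
      ≤ ∫ ω, truncSum e Z P n S ω ^ 2 ∂P) ∧
    ∫ ω, truncSum e Z P n S ω ^ 3 ∂P ≤ 8 * (n * (∑ i ∈ Finset.Ioo (-(n : ℤ)) n,
      hsNorm e (autoCov Z P i) ^ (3 / 2 : ℝ)) ^ 2) ∧
    ∫ ω, truncSum e Z P n S ω ^ 4 ∂P - 3 * (∫ ω, truncSum e Z P n S ω ^ 2 ∂P) ^ 2
      ≤ 48 * (n * (∑ i ∈ Finset.Ioo (-(n : ℤ)) n,
        hsNorm e (autoCov Z P i) ^ (4 / 3 : ℝ)) ^ 3) := by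
  classical
  let X : Finset.Icc (1 : ℤ) n × S → Ω → ℝ := fun a ω => inner ℝ (Z a.1 ω) (e a.2)
  have hXG : HasGaussianLaw (fun ω a => X a ω) P := by
    have h := (isGaussianProcess_coord e hZ).hasGaussianLaw (Finset.Icc (1 : ℤ) n ×ˢ S)
    let L : ((Finset.Icc (1 : ℤ) n ×ˢ S : Finset (ℤ × ι)) → ℝ) →L[ℝ]
        (Finset.Icc (1 : ℤ) n × S → ℝ) :=
      ContinuousLinearMap.pi fun a =>
        ContinuousLinearMap.proj ⟨(a.1.1, a.2.1), Finset.mk_mem_product a.1.2 a.2.2⟩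
    exact h.map_fun L
  have hM : ∀ a b, momentMatrix X P a b
      = inner ℝ (autoCov Z P (a.1 - b.1) (e a.2)) (e b.2) := fun a b =>
    integral_inner_mul_inner hZ hZ0 hstat _ _ _ _
  have hX0 : ∀ a, ∫ ω, X a ω ∂P = 0 := fun a => by
    have := integral_inner (𝕜 := ℝ) (hZ.hasGaussianLaw_eval a.1).integrable (e a.2)
    rw [hZ0, inner_zero_right] at this
    simpa [X, real_inner_comm] using this
  have hW : ∀ ω, truncSum e Z P n S ω = ∑ a, (X a ω ^ 2 - momentMatrix X P a a) := fun ω => by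
    simp only [hM, sub_self, X, Fintype.sum_prod_type, truncSum]
    rw [← Finset.sum_coe_sort (Finset.Icc (1 : ℤ) n)]
    refine Finset.sum_congr rfl fun i _ => ?_
    rw [← Finset.sum_coe_sort S]
  have hh : ∀ i j : Finset.Icc (1 : ℤ) n, √(∑ k, ∑ l, momentMatrix X P (i, k) (j, l) ^ 2)
      ≤ hsNorm e (autoCov Z P (i - j)) := fun i j => by
    simp only [hM]
    exact sqrt_sum_inner_sq_le_hsNorm e (isHilbertSchmidt_autoCov e hZ hZ0 hstat _) S
  have hq : ∀ i, 0 ≤ hsNorm e (autoCov Z P i) := fun i => Real.sqrt_nonneg _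
  have t3 := sum_toeplitz_three_le (n := n) hq
  have t4 := sum_toeplitz_four_le (n := n) hq
  have h3 := (trace_pow_three_le _ hh).trans t3
  have h4 := (trace_pow_four_le _ hh).trans t4
  obtain ⟨m1, m2, m3, m4⟩ := moments_quadratic_of_hasGaussianLaw hXG hX0 hW
  refine ⟨m1, fun hn k hk => ?_, ?_, ?_⟩
  · rw [m2]
    gcongr 2 * ?_
    -- By symmetry `tr M²` is the sum of all squared entries; the diagonal entry at time `1` and
    -- coordinate `k` is kept.
    let a : Finset.Icc (1 : ℤ) n × S := (⟨1, by simpa using hn⟩, ⟨k, hk⟩)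
    have hsym : ∀ a b, momentMatrix X P a b * momentMatrix X P b a
        = momentMatrix X P a b ^ 2 := fun a b => by
      rw [sq, ← (isHermitian_momentMatrix X).apply b a]; simp
    have ha : momentMatrix X P a a = inner ℝ (autoCov Z P 0 (e k)) (e k) := by
      rw [hM]; simp [a]
    simp only [sq (momentMatrix X P), Matrix.trace, Matrix.diag, Matrix.mul_apply, hsym]
    rw [← ha]
    exact (Finset.single_le_sum (f := fun b => momentMatrix X P a b ^ 2)
      (fun b _ => sq_nonneg _) (Finset.mem_univ a)).trans
      (Finset.single_le_sum (f := fun a => ∑ b, momentMatrix X P a b ^ 2)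
      (fun b _ => Finset.sum_nonneg fun _ _ => sq_nonneg _) (Finset.mem_univ a))
  · rw [m3]
    exact mul_le_mul_of_nonneg_left h3 (by norm_num)
  · rw [m4]
    exact mul_le_mul_of_nonneg_left h4 (by norm_num)

theorem moments_fullSum_le [Countable ι] (n : ℕ) :
    ∫ ω, fullSum e Z P n ω ∂P = 0 ∧
    (1 ≤ n → ∀ k, 2 * inner ℝ (autoCov Z P 0 (e k)) (e k) ^ 2
      ≤ ∫ ω, fullSum e Z P n ω ^ 2 ∂P) ∧
    ∫ ω, fullSum e Z P n ω ^ 3 ∂P ≤ 8 * (n * (∑ i ∈ Finset.Ioo (-(n : ℤ)) n,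
      hsNorm e (autoCov Z P i) ^ (3 / 2 : ℝ)) ^ 2) ∧
    ∫ ω, fullSum e Z P n ω ^ 4 ∂P - 3 * (∫ ω, fullSum e Z P n ω ^ 2 ∂P) ^ 2
      ≤ 48 * (n * (∑ i ∈ Finset.Ioo (-(n : ℤ)) n,
        hsNorm e (autoCov Z P i) ^ (4 / 3 : ℝ)) ^ 3) := by
  have ht := tendsto_integral_truncSum_pow e hZ hZ0 hstat n
  have hb := moments_truncSum_le e hZ hZ0 hstat n
  refine ⟨?_, fun hn k => ?_, ?_, ?_⟩
  · have h1 := ht 1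
    simp only [pow_one, (hb _).1] at h1
    exact tendsto_nhds_unique h1 tendsto_const_nhds
  · refine ge_of_tendsto (ht 2) ?_
    filter_upwards [eventually_ge_atTop {k}] with S hS
    exact (hb S).2.1 hn k (Finset.singleton_subset_iff.1 hS)
  · exact le_of_tendsto (ht 3) (Eventually.of_forall fun S => (hb S).2.2.1)
  · exact le_of_tendsto ((ht 4).sub (((ht 2).pow 2).const_mul 3))
      (Eventually.of_forall fun S => (hb S).2.2.2)

end Truncation

end GaussSeq

/-! ### Normalisation and conclusion -/

theorem mainTheorem7 :
    ∃ C₂ : ℝ, 0 < C₂ ∧ ∀ C₁ : ℝ, 8 < C₁ →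
      ∀ (V : Type*) [NormedAddCommGroup V] [InnerProductSpace ℝ V] [CompleteSpace V]
        [TopologicalSpace.SeparableSpace V] [MeasurableSpace V] [BorelSpace V]
        (ι : Type*) (e : HilbertBasis ι ℝ V)
        (Ω : Type*) [MeasurableSpace Ω] (P : Measure Ω) [IsProbabilityMeasure P]
        (Z : ℤ → Ω → V),
        IsGaussianProcess Z P →
        (∀ i, ∫ ω, Z i ω ∂P = 0) →
        GaussSeq.IsStationary Z P →
        GaussSeq.autoCov Z P 0 ≠ 0 →
        GaussSeq.HasTrace e (GaussSeq.autoCov Z P 0) ∧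
        (∀ i, GaussSeq.IsHilbertSchmidt e (GaussSeq.autoCov Z P i)) ∧
        ∀ n : ℕ, 1 ≤ n →
          0 < GaussSeq.sampleS e Z P n ∧
          MemLp (GaussSeq.sampleF e Z P n) 4 P ∧
          GaussSeq.cumulant (GaussSeq.sampleF e Z P n) P 3 ≤
            C₁ / (√(n : ℝ) * GaussSeq.sampleS e Z P n ^ (3 / 2 : ℝ)) *
              (∑ i ∈ Finset.Ioo (-(n : ℤ)) n,
                GaussSeq.hsNorm e (GaussSeq.autoCov Z P i) ^ (3 / 2 : ℝ)) ^ 2 ∧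
          GaussSeq.cumulant (GaussSeq.sampleF e Z P n) P 4 ≤
            C₂ / ((n : ℝ) * GaussSeq.sampleS e Z P n ^ 2) *
              (∑ i ∈ Finset.Ioo (-(n : ℤ)) n,
                GaussSeq.hsNorm e (GaussSeq.autoCov Z P i) ^ (4 / 3 : ℝ)) ^ 3 := by
  refine ⟨48, by norm_num, ?_⟩
  intro C₁ hC₁ V _ _ _ _ _ _ ι e Ω _ P _ Z hZ hZ0 hstat hQ
  have : SecondCountableTopology V := UniformSpace.secondCountable_of_separable V
  have : Countable ι := GaussSeq.countable_of_hilbertBasis e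
  refine ⟨GaussSeq.hasTrace_autoCov_zero e hZ hZ0 hstat,
    GaussSeq.isHilbertSchmidt_autoCov e hZ hZ0 hstat, fun n hn => ?_⟩
  have hn0 : (0 : ℝ) < n := by exact_mod_cast hn
  obtain ⟨m1, m2, m3, m4⟩ := GaussSeq.moments_fullSum_le e hZ hZ0 hstat n
  set A := ∑ i ∈ Finset.Ioo (-(n : ℤ)) n,
    GaussSeq.hsNorm e (GaussSeq.autoCov Z P i) ^ (3 / 2 : ℝ)
  set B := ∑ i ∈ Finset.Ioo (-(n : ℤ)) n,
    GaussSeq.hsNorm e (GaussSeq.autoCov Z P i) ^ (4 / 3 : ℝ)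
  obtain ⟨k, hk⟩ := GaussSeq.exists_inner_autoCov_zero_ne_zero e hZ hZ0 hstat hQ
  have hpos : 0 < ∫ ω, GaussSeq.fullSum e Z P n ω ^ 2 ∂P :=
    lt_of_lt_of_le (by positivity) (m2 hn k)
  have hV : ∀ ω, GaussSeq.sampleV e Z P n ω = 1 / √(n : ℝ) * GaussSeq.fullSum e Z P n ω :=
    fun ω => rfl
  have hS : GaussSeq.sampleS e Z P n = (∫ ω, GaussSeq.fullSum e Z P n ω ^ 2 ∂P) / n := by
    simp only [GaussSeq.sampleS, hV, mul_pow, integral_const_mul]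
    rw [div_pow, Real.sq_sqrt hn0.le]; ring
  have hs : 0 < GaussSeq.sampleS e Z P n := by rw [hS]; positivity
  set s := GaussSeq.sampleS e Z P n with hsdef
  -- `F_n` is `c` times the full sum, with `c³ n = 1/(√n s^(3/2))` and `c⁴ n = 1/(n s²)`.
  set c := 1 / √(n : ℝ) / √s with hc
  have hF : ∀ ω, GaussSeq.sampleF e Z P n ω = c * GaussSeq.fullSum e Z P n ω := fun ω => by
    rw [GaussSeq.sampleF, hV, ← hsdef, hc]; ring
  have hFm : ∀ m : ℕ, ∫ ω, GaussSeq.sampleF e Z P n ω ^ m ∂P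
      = c ^ m * ∫ ω, GaussSeq.fullSum e Z P n ω ^ m ∂P := fun m => by
    simp only [hF, mul_pow, integral_const_mul]
  have hF1 : ∫ ω, GaussSeq.sampleF e Z P n ω ∂P = 0 := by
    simpa [m1] using hFm 1
  have hs3 : s ^ (3 / 2 : ℝ) = √s ^ 3 := by
    rw [Real.sqrt_eq_rpow, ← Real.rpow_mul_natCast hs.le]; norm_num
  have hc0 : 0 < c := by positivity
  have hsn : √(n : ℝ) ^ 2 = n := Real.sq_sqrt hn0.le
  have hss : √s ^ 2 = s := Real.sq_sqrt hs.le
  refine ⟨hs, ?_, ?_, ?_⟩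
  · rw [funext hF]
    exact ((GaussSeq.hasAllMoments_fullSum e hZ n).const_mul c).memLp (by simp)
  · rw [GaussSeq.cumulant_three, hF1, hFm 3, hs3]
    calc _ = c ^ 3 * ∫ ω, GaussSeq.fullSum e Z P n ω ^ 3 ∂P := by ring
      _ ≤ c ^ 3 * (8 * (n * A ^ 2)) := by gcongr
      _ = 8 / (√(n : ℝ) * √s ^ 3) * A ^ 2 := by
        rw [hc]
        field_simp
        rw [hsn]
      -- The bound already holds with `8`; only `8 ≤ C₁` is needed.
      _ ≤ _ := by gcongr
  · rw [GaussSeq.cumulant_four, hF1, hFm 4, hFm 2]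
    calc _ = c ^ 4 * (∫ ω, GaussSeq.fullSum e Z P n ω ^ 4 ∂P
          - 3 * (∫ ω, GaussSeq.fullSum e Z P n ω ^ 2 ∂P) ^ 2) := by ring
      _ ≤ c ^ 4 * (48 * (n * B ^ 3)) := by gcongr
      _ = _ := by
        have h4 : c ^ 4 = 1 / (n ^ 2 * s ^ 2) := by
          rw [hc, ← hsn, ← hss]
          simp only [Real.sqrt_sq (Real.sqrt_nonneg _)]
          field_simp
        rw [h4]
        field_simp
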